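/- All graphs are finite and simple. For a graph $G$, a set function associated with $G$ assigns to every vertex $v$ a set $H(v)\subseteq\{0,1,\dots,d_G(v)\}$. An $H$-factor of $G$ is a spanning subgraph $F$ with $d_F(v)\in H(v)$ for every vertex $v$. Write $mH=\min_{v}\min H(v)$ and $MH=\max_{v}\max H(v)$. **Theorem 1.9.** (a) Let $r$ be a nonnegative integer, let $G$ be a graph in which every vertex has degree $r$ or $r+1$, and let $H$ be a set function associated with $G$. If $mH\ge 1$, $MH\le r$ and $$|H(v)|\ \ge\ \frac{MH-mH+3}{2}\qquad\text{for every vertex } v,$$ then $G$ has an $H$-factor. (b) The bound in (a) is sharp, in the following sense. (i) For every even integer $r$ and all odd positive integers $m\le M\le \frac r2-2$ there is an $r$-regular graph $G$ of even order such that, with $H(v)=\{m,m+2,m+4,\dots,M\}$ for all $v$ (so that $mH=m$, $MH=M$ and $|H(v)|=\frac{M-m+2}{2}$), $G$ has no $H$-factor. (ii) For all integers $1\le m\le M$ there are an integer $r\ge M$, an $r$-regular graph $G$ and a set function $H$ associated with $G$ such that $mH=m$, $MH=M$, $|H(v)|=\bigl\lfloor\frac{M-m+2}{2}\bigr\rfloor$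 for every vertex $v$, and $G$ has no $H$-factor. -/

import Mathlib

namespace GeneralFactor

/-- Every vertex of `G` has degree `r` or `r + 1`. -/
def IsNearRegular {V : Type*} [Fintype V] (G : SimpleGraph V) [DecidableRel G.Adj]
    (r : ℕ) : Prop :=
  ∀ v, G.degree v = r ∨ G.degree v = r + 1

/-- `H` is a set function associated with `G`: `H v ⊆ {0, 1, …, deg v}` for every vertex `v`. -/
def IsSetFunction {V : Type*} [Fintype V] (G : SimpleGraph V) [DecidableRel G.Adj]
    (H : V → Set ℕ) : Prop :=
  ∀ v, H v ⊆ Set.Icc 0 (G.degree v)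

/-- `G` has an `H`-factor: a spanning subgraph `F` (same vertex set, edges among those of `G`)
in which the degree of every vertex `v` belongs to `H v`. -/
def HasFactor {V : Type*} [Fintype V] (G : SimpleGraph V) (H : V → Set ℕ) : Prop :=
  ∃ (F : SimpleGraph V) (_ : DecidableRel F.Adj), F ≤ G ∧ ∀ v, F.degree v ∈ H v

/-- `min_v min H(v)`. (If some `H v` is empty, or if there is no vertex, the value is `0`.) -/
noncomputable def minH {V : Type*} (H : V → Set ℕ) : ℕ := ⨅ v, sInf (H v)

/-- `max_v max H(v)`, for a finite vertex set and finite sets `H v`. -/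
noncomputable def maxH {V : Type*} (H : V → Set ℕ) : ℕ := ⨆ v, sSup (H v)

end GeneralFactor

namespace GeneralFactor

open Finset

/-! Write m, M for the extreme values and k = ⌊(M - m + 2) / 2⌋; the hypothesis says |H(v)| ≥ k + 1.
Choose disjoint factors F, K with deg F ≤ m, deg F + deg K ≥ M and deg K ≤ 2k
(`exists_interval_factors`); it remains to add some edges of K to F. Among the deg K + 1 conceivable
numbers of added edges at v, at most deg K - k are bad. Orienting K with indegrees at most k leaves
at least that many arcs out of v, and a greedy induction (`exists_avoiding_arcs`) then avoids all
bad numbers at once.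

Building F and K rests on Hall's theorem, which yields balanced orientations, Petersen's 2-factors,
and matchings covering the vertices of larger degree; removing such matchings repeatedly gives
Tutte's near-regular factors.

Sharpness is parity. An odd clique has no factor with all degrees odd, no graph has exactly one
vertex of odd degree, and a factor with all degrees even cannot use a bridge. -/

/-- A form of Hall's theorem: a bipartite relation in which all degrees on the left are at least
`a > 0` and all degrees on the right are at most `a` contains a matching saturating the left. -/
theorem exists_injective_of_card_le {α β : Type*} [Fintype α] [Fintype β] [DecidableEq β]
    (R : α → β → Prop) [∀ x y, Decidable (R x y)] (a : ℕ) (ha : 0 < a)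
    (hl : ∀ x, a ≤ #{y | R x y}) (hr : ∀ y, #{x | R x y} ≤ a) :
    ∃ f : α → β, Function.Injective f ∧ ∀ x, R x (f x) := by
  obtain ⟨f, hf, h⟩ := (Finset.all_card_le_biUnion_card_iff_exists_injective
    (fun x => ({y | R x y} : Finset β))).1 (by
      intro s
      set t := s.biUnion (fun x => ({y | R x y} : Finset β)) with ht
      have h := Finset.card_nsmul_le_card_nsmul (s := s) (t := t) R (m := a) (n := a) ?_ ?_
      · simp only [smul_eq_mul] at h
        exact Nat.le_of_mul_le_mul_right h ha
      · intro x hx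
        refine (hl x).trans (card_le_card ?_)
        intro y hy
        simp only [mem_filter, mem_univ, true_and] at hy
        simp only [bipartiteAbove, mem_filter, ht, mem_biUnion]
        exact ⟨⟨x, hx, by simpa using hy⟩, hy⟩
      · intro y _
        refine le_trans (card_le_card ?_) (hr y)
        intro x hx
        simp only [bipartiteBelow, mem_filter] at hx
        simpa using hx.2)
  exact ⟨f, hf, fun x => by simpa using h x⟩

/-! ### Degree bookkeeping -/

variable {V : Type*}

/-- The degree of a vertex, as a cardinality that involves no decidability instance. -/
noncomputable def deg (G : SimpleGraph V) (v : V) : ℕ := (G.neighborSet v).ncard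

theorem degree_eq_deg [Fintype V] (G : SimpleGraph V) [DecidableRel G.Adj] (v : V) :
    G.degree v = deg G v := by
  rw [deg, Set.ncard_eq_toFinset_card']
  rfl

section Finite

variable [Finite V]

theorem deg_mono {F G : SimpleGraph V} (h : F ≤ G) (v : V) : deg F v ≤ deg G v :=
  Set.ncard_le_ncard (fun _ hw => h hw) (Set.toFinite _)

theorem deg_sup {F G : SimpleGraph V} (h : Disjoint F G) (v : V) :
    deg (F ⊔ G) v = deg F v + deg G v := by
  rw [deg, deg, deg, ← Set.ncard_union_eq _ (Set.toFinite _) (Set.toFinite _)]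
  · rfl
  · rw [Set.disjoint_left]
    intro w hF hG
    exact (SimpleGraph.disjoint_left.1 h) v w hF hG

theorem deg_add_deg_sdiff {F G : SimpleGraph V} (h : F ≤ G) (v : V) :
    deg F v + deg (G \ F) v = deg G v := by
  rw [← deg_sup disjoint_sdiff_self_right, sup_sdiff_cancel_right h]

end Finite

/-! ### Orientations and even factors -/

/-- A graph of maximum degree at most `2 * k` has an orientation of maximum indegree at
most `k`. -/
theorem exists_orientation [Finite V] (G : SimpleGraph V) (k : ℕ) (h : ∀ v, deg G v ≤ 2 * k) :
    ∃ D : V → V → Prop, (∀ v w, G.Adj v w ↔ D v w ∨ D w v) ∧ (∀ v w, D v w → ¬ D w v) ∧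
      ∀ w, {v | D v w}.ncard ≤ k := by
  classical
  have := Fintype.ofFinite V
  rcases Nat.eq_zero_or_pos k with rfl | hk
  · refine ⟨fun _ _ => False, fun v w => ?_, by simp, by simp⟩
    simp only [or_self, iff_false]
    intro hvw
    have h0 := h v
    simp only [mul_zero, nonpos_iff_eq_zero, deg, Set.ncard_eq_zero (Set.toFinite _)] at h0
    exact (h0 ▸ (show w ∈ G.neighborSet v from hvw) : w ∈ (∅ : Set V))
  -- Each vertex offers k slots, and each edge claims a slot at one of its ends, which becomes its
  -- head. An edge sees 2k slots; a slot at v is seen by deg v ≤ 2k edges.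
  obtain ⟨g, hg, hmem⟩ := exists_injective_of_card_le
    (fun (e : G.edgeSet) (p : V × Fin k) => p.1 ∈ (e : Sym2 V)) (2 * k) (by omega)
    (by
      rintro ⟨e, he⟩
      induction e using Sym2.ind with
      | _ a b =>
        have hab : a ≠ b := G.ne_of_adj he
        have : ({p : V × Fin k | p.1 ∈ s(a, b)} : Finset _) = ({a, b} : Finset V) ×ˢ univ := by
          ext p
          simp
        rw [this, card_product, card_pair hab, card_univ, Fintype.card_fin])
    (by
      rintro ⟨v, i⟩
      refine le_trans ?_ (h v)
      rw [← degree_eq_deg, ← SimpleGraph.card_incidenceFinset_eq_degree,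
        ← card_map (Function.Embedding.subtype _)]
      refine card_le_card ?_
      intro e he
      simp only [mem_map, mem_filter, mem_univ, true_and, Function.Embedding.subtype_apply,
        Subtype.exists, exists_and_left, exists_prop, exists_eq_right_right] at he
      simpa [SimpleGraph.incidenceSet] using he.symm)
  refine ⟨fun v w => ∃ hvw : s(v, w) ∈ G.edgeSet, (g ⟨s(v, w), hvw⟩).1 = w, ?_, ?_, ?_⟩
  · intro v w
    constructor
    · intro hvw
      have := hmem ⟨s(v, w), hvw⟩
      simp only [Sym2.mem_iff] at this
      rcases this with h1 | h1
      · right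
        refine ⟨(G.mem_edgeSet).2 hvw.symm, ?_⟩
        have e : (⟨s(w, v), hvw.symm⟩ : G.edgeSet) = ⟨s(v, w), hvw⟩ := by
          ext1; exact Sym2.eq_swap
        rw [e, h1]
      · exact Or.inl ⟨hvw, h1⟩
    · rintro (⟨h1, _⟩ | ⟨h1, _⟩)
      · exact h1
      · exact ((G.mem_edgeSet).1 h1).symm
  · rintro v w ⟨h1, h2⟩ ⟨h3, h4⟩
    have e : (⟨s(w, v), h3⟩ : G.edgeSet) = ⟨s(v, w), h1⟩ := by
      ext1; exact Sym2.eq_swap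
    rw [e, h2] at h4
    exact G.ne_of_adj h1 h4.symm
  · intro w
    rw [← Nat.card_coe_set_eq]
    have : Function.Injective (fun x : {v | ∃ hvw : s(v, w) ∈ G.edgeSet, (g ⟨s(v, w), hvw⟩).1 = w} =>
        (g ⟨s(x.1, w), x.2.choose⟩).2) := by
      rintro ⟨x, hx⟩ ⟨y, hy⟩ hxy
      have hx1 := hx.choose_spec
      have hy1 := hy.choose_spec
      have := hg (Prod.ext (hx1.trans hy1.symm) hxy)
      simp only [Subtype.mk.injEq, Sym2.eq_iff] at this
      ext1
      rcases this with h1 | h1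
      · exact h1.1
      · exact h1.1.trans h1.2
    simpa using Nat.card_le_card_of_injective _ this

theorem deg_eq_out_add_in [Finite V] (G : SimpleGraph V) (D : V → V → Prop)
    (h1 : ∀ v w, G.Adj v w ↔ D v w ∨ D w v) (h2 : ∀ v w, D v w → ¬ D w v) (v : V) :
    deg G v = {w | D v w}.ncard + {w | D w v}.ncard := by
  rw [deg, ← Set.ncard_union_eq _ (Set.toFinite _) (Set.toFinite _)]
  · congr 1
    ext w
    exact h1 v w
  · rw [Set.disjoint_left]
    exact fun w => h2 v w

/-- Petersen's theorem: a regular graph of positive even degree has a `2`-factor. -/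
theorem exists_two_factor [Finite V] (G : SimpleGraph V) (j : ℕ) (hj : 0 < j)
    (h : ∀ v, deg G v = 2 * j) : ∃ F ≤ G, ∀ v, deg F v = 2 := by
  classical
  have := Fintype.ofFinite V
  obtain ⟨D, h1, h2, h3⟩ := exists_orientation G j (fun v => (h v).le)
  have hout : ∀ v, j ≤ {w | D v w}.ncard := by
    intro v
    have := deg_eq_out_add_in G D h1 h2 v
    have := h v
    have := h3 v
    omega
  obtain ⟨f, hf, hD⟩ := exists_injective_of_card_le D j hj
    (fun v => by
      have := hout v
      rwa [Set.ncard_eq_toFinset_card', Set.toFinset_ofPred] at this)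
    (fun v => by
      have := h3 v
      rwa [Set.ncard_eq_toFinset_card', Set.toFinset_ofPred] at this)
  -- The permutation f follows arcs, so its cycles form the 2-factor; antisymmetry of `D` excludes
  -- fixed points and 2-cycles.
  have hbij : Function.Bijective f := Finite.injective_iff_bijective.1 hf
  let F : SimpleGraph V :=
    { Adj := fun v w => f v = w ∨ f w = v
      symm := ⟨fun v w h => h.symm⟩
      loopless := ⟨fun v h => by
        have hv : f v = v := by simpa using h
        have h' := hD v
        rw [hv] at h'
        exact h2 v v h' h'⟩ }
  refine ⟨F, ?_, fun v => ?_⟩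
  · rintro v w (h | h)
    · exact (h1 v w).2 (Or.inl (h ▸ hD v))
    · exact (h1 v w).2 (Or.inr (h ▸ hD w))
  · obtain ⟨u, hu⟩ := hbij.2 v
    have : F.neighborSet v = {f v, u} := by
      ext w
      simp only [SimpleGraph.mem_neighborSet, F, Set.mem_insert_iff, Set.mem_singleton_iff]
      constructor
      · rintro (h | h)
        · exact Or.inl h.symm
        · exact Or.inr (hf (h.trans hu.symm))
      · rintro (rfl | rfl)
        · exact Or.inl rfl
        · exact Or.inr hu
    rw [deg, this, Set.ncard_pair]
    rintro rfl
    have h' := hD (f v)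
    rw [hu] at h'
    exact h2 _ _ (hD v) h'

/-- Removing a 2-factor from a 2j-regular graph leaves a 2(j - 1)-regular one; peel until the degree
is 2l. -/
theorem exists_even_factor [Finite V] (j : ℕ) (G : SimpleGraph V) (h : ∀ v, deg G v = 2 * j)
    (l : ℕ) (hl : l ≤ j) : ∃ F ≤ G, ∀ v, deg F v = 2 * l := by
  induction j generalizing G with
  | zero => exact ⟨G, le_rfl, fun v => by rw [h v]; omega⟩
  | succ j ih =>
    rcases hl.eq_or_lt with rfl | hlt
    · exact ⟨G, le_rfl, h⟩
    obtain ⟨F, hF, hF2⟩ := exists_two_factor G (j + 1) j.succ_pos h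
    obtain ⟨F', hF', hF2'⟩ := ih (G \ F) (fun v => by
      have := deg_add_deg_sdiff hF v
      have := hF2 v
      have := h v
      omega) (by omega)
    exact ⟨F', hF'.trans sdiff_le, hF2'⟩

/-- Two copies of `G`, with the two copies of each vertex of `S` joined. -/
def double (G : SimpleGraph V) (S : Set V) : SimpleGraph (V × Bool) where
  Adj p q := (p.2 = q.2 ∧ G.Adj p.1 q.1) ∨ (p.2 ≠ q.2 ∧ p.1 = q.1 ∧ p.1 ∈ S)
  symm := ⟨by
    rintro p q (⟨h1, h2⟩ | ⟨h1, h2, h3⟩)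
    · exact Or.inl ⟨h1.symm, h2.symm⟩
    · exact Or.inr ⟨h1.symm, h2.symm, h2 ▸ h3⟩⟩
  loopless := ⟨by
    rintro p (⟨_, h⟩ | ⟨h, _⟩)
    · exact G.loopless.irrefl _ h
    · exact h rfl⟩

open Classical in
theorem deg_double [Finite V] (G : SimpleGraph V) (S : Set V) (p : V × Bool) :
    deg (double G S) p = deg G p.1 + if p.1 ∈ S then 1 else 0 := by
  have : (double G S).neighborSet p = (fun w => (w, p.2)) '' G.neighborSet p.1 ∪
      (if p.1 ∈ S then {(p.1, !p.2)} else ∅) := by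
    obtain ⟨v, b⟩ := p
    ext ⟨w, c⟩
    simp only [SimpleGraph.mem_neighborSet, double, Set.mem_union, Set.mem_image, Prod.mk.injEq]
    split_ifs with h <;> cases b <;> cases c <;> simp [h, eq_comm]
  rw [deg, this, Set.ncard_union_eq _ (Set.toFinite _) (Set.toFinite _),
    Set.ncard_image_of_injective _ (fun a b h => by simpa using h)]
  · congr 1
    split_ifs <;> simp
  · rw [Set.disjoint_left]
    rintro _ ⟨w, _, rfl⟩
    split_ifs <;> simp

/-- A graph with all degrees in `{2 * j - 1, 2 * j}` splits into two graphs of maximum degree at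
most `2 * l` and `2 * (j - l)`. -/
theorem exists_even_split [Finite V] (G : SimpleGraph V) (j l : ℕ) (hl : l ≤ j)
    (h1 : ∀ v, deg G v ≤ 2 * j) (h2 : ∀ v, 2 * j ≤ deg G v + 1) :
    ∃ F ≤ G, (∀ v, deg F v ≤ 2 * l) ∧ ∀ v, deg (G \ F) v ≤ 2 * (j - l) := by
  classical
  -- Joining the two copies of each vertex of degree 2j - 1 makes the double 2j-regular; an even
  -- factor of it and its complement are then restricted to one copy.
  set K := double G {v | deg G v + 1 = 2 * j} with hK
  have hreg : ∀ p, deg K p = 2 * j := by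
    intro p
    rw [hK, deg_double]
    have := h1 p.1
    have := h2 p.1
    simp only [Set.mem_ofPred_eq]
    split_ifs <;> omega
  obtain ⟨F, hF, hF2⟩ := exists_even_factor j K hreg l hl
  have hinj : Function.Injective (fun v : V => (v, true)) := fun a b h => by simpa using h
  refine ⟨F.comap (fun v => (v, true)), ?_, fun v => ?_, fun v => ?_⟩
  · intro v w hvw
    have : K.Adj (v, true) (w, true) := hF hvw
    simpa [hK, double] using this
  · rw [← hF2 (v, true), deg, deg, ← Set.ncard_image_of_injective _ hinj]
    refine Set.ncard_le_ncard ?_ (Set.toFinite _)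
    rintro _ ⟨w, hw, rfl⟩
    exact hw
  · have : deg (K \ F) (v, true) = 2 * (j - l) := by
      have := deg_add_deg_sdiff hF (v, true)
      rw [hF2, hreg] at this
      omega
    rw [← this, deg, deg, ← Set.ncard_image_of_injective _ hinj]
    refine Set.ncard_le_ncard ?_ (Set.toFinite _)
    rintro _ ⟨w, hw, rfl⟩
    have hw' : G.Adj v w ∧ ¬ F.Adj (v, true) (w, true) := hw
    refine ⟨?_, hw'.2⟩
    simpa [hK, double] using hw'.1

/-! ### Near-regular factors -/

/-- An edge-minimal factor with degrees in `{r, r + 1}` contains a matching that covers all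
vertices of degree `r + 1`. -/
theorem exists_factor_with_matching {V : Type*} [Finite V] (G : SimpleGraph V) (r : ℕ)
    (h : ∀ v, deg G v = r ∨ deg G v = r + 1) :
    ∃ G' ≤ G, (∀ v, deg G' v = r ∨ deg G' v = r + 1) ∧
      ∃ T ≤ G', (∀ v, deg T v ≤ 1) ∧ ∀ v, deg G' v = r + 1 → deg T v = 1 := by
  classical
  have := Fintype.ofFinite V
  obtain ⟨G', hG', hmin⟩ := (Set.toFinite
    {K : SimpleGraph V | K ≤ G ∧ ∀ v, deg K v = r ∨ deg K v = r + 1}).exists_le_minimal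
    (a := G) ⟨le_rfl, h⟩
  obtain ⟨⟨-, hd⟩, hmin⟩ := hmin
  -- An edge between two vertices of degree r + 1 could be deleted, contradicting minimality. So
  -- Hall's theorem matches these vertices into the others, and the chosen edges form a matching.
  have hind : ∀ u v, deg G' u = r + 1 → deg G' v = r + 1 → ¬ G'.Adj u v := by
    intro u v hu hv huv
    let E : SimpleGraph V :=
      { Adj := fun a b => (a = u ∧ b = v) ∨ (a = v ∧ b = u)
        symm := ⟨fun a b h => by tauto⟩
        loopless := ⟨fun a h => by
          rcases h with ⟨h1, h2⟩ | ⟨h1, h2⟩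
          · exact huv.ne (h1.symm.trans h2)
          · exact huv.ne (h2.symm.trans h1)⟩ }
    have hE : E ≤ G' := by
      rintro a b (⟨rfl, rfl⟩ | ⟨rfl, rfl⟩)
      · exact huv
      · exact huv.symm
    have hEd : ∀ w, deg E w = if w = u ∨ w = v then 1 else 0 := by
      intro w
      rw [deg]
      split_ifs with hw
      · rw [Set.ncard_eq_one]
        rcases hw with rfl | rfl
        · refine ⟨v, ?_⟩
          ext x
          have := huv.ne
          simp [E, SimpleGraph.neighborSet, this]
        · refine ⟨u, ?_⟩
          ext x
          have := huv.ne'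
          simp [E, SimpleGraph.neighborSet, this]
      · rw [Set.ncard_eq_zero (Set.toFinite _)]
        ext x
        simp only [E, SimpleGraph.mem_neighborSet, Set.mem_empty_iff_false, iff_false]
        tauto
    have hle := hmin (y := G' \ E) ⟨sdiff_le.trans hG', fun w => by
      have h1 := deg_add_deg_sdiff hE w
      rw [hEd] at h1
      split_ifs at h1 with hw
      · rcases hw with rfl | rfl <;> omega
      · have := hd w
        omega⟩ sdiff_le
    exact (hle huv).2 (Or.inl ⟨rfl, rfl⟩)
  obtain ⟨f, hf, hR⟩ := exists_injective_of_card_le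
    (fun (u : {u // deg G' u = r + 1}) w => G'.Adj u w) (r + 1) r.succ_pos
    (fun u => by
      have := u.2
      rw [deg, Set.ncard_eq_toFinset_card'] at this
      refine this.ge.trans (card_le_card ?_)
      intro w hw
      simpa using hw)
    (fun w => by
      have : deg G' w ≤ r + 1 := by have := hd w; omega
      rw [deg, Set.ncard_eq_toFinset_card'] at this
      refine le_trans ?_ this
      rw [← card_map (Function.Embedding.subtype _)]
      refine card_le_card ?_
      intro x hx
      simp only [mem_map, mem_filter, mem_univ, true_and, Function.Embedding.subtype_apply] at hx
      obtain ⟨a, ha, rfl⟩ := hx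
      simpa using ha.symm)
  have hfU : ∀ u, deg G' (f u) ≠ r + 1 := fun u hu => hind _ _ u.2 hu (hR u)
  let T : SimpleGraph V :=
    { Adj := fun a b => (∃ h : deg G' a = r + 1, f ⟨a, h⟩ = b) ∨
        (∃ h : deg G' b = r + 1, f ⟨b, h⟩ = a)
      symm := ⟨fun a b h => h.symm⟩
      loopless := ⟨fun a h => by
        have h' : ∃ h : deg G' a = r + 1, f ⟨a, h⟩ = a := by simpa using h
        obtain ⟨h1, h2⟩ := h'
        exact hfU ⟨a, h1⟩ (by rw [h2, h1])⟩ }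
  have hTU : ∀ v, deg G' v = r + 1 → deg T v = 1 := by
    intro v hv
    rw [deg, Set.ncard_eq_one]
    refine ⟨f ⟨v, hv⟩, ?_⟩
    ext w
    simp only [T, SimpleGraph.mem_neighborSet, Set.mem_singleton_iff]
    constructor
    · rintro (⟨_, h2⟩ | ⟨h1, h2⟩)
      · exact h2.symm
      · exact absurd hv (h2 ▸ hfU _)
    · rintro rfl
      exact Or.inl ⟨hv, rfl⟩
  refine ⟨G', hG', hd, T, ?_, fun v => ?_, hTU⟩
  · rintro a b (⟨h1, h2⟩ | ⟨h1, h2⟩)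
    · exact h2 ▸ hR ⟨a, h1⟩
    · exact h2 ▸ (hR ⟨b, h1⟩).symm
  · by_cases hv : deg G' v = r + 1
    · exact (hTU v hv).le
    · rw [deg, Set.ncard_le_one (Set.toFinite _)]
      rintro a (⟨h1, _⟩ | ⟨h1, h2⟩) b (⟨h3, _⟩ | ⟨h3, h4⟩)
      · exact absurd h1 hv
      · exact absurd h1 hv
      · exact absurd h3 hv
      · exact congrArg Subtype.val (hf (h2.trans h4.symm))

/-- Tutte's theorem: a graph with all degrees in `{r, r + 1}` has a factor with all degrees in
`{k, k + 1}`, for every `k ≤ r`. -/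
theorem exists_near_regular_factor {V : Type*} [Finite V] (G : SimpleGraph V) (r k : ℕ)
    (hk : k ≤ r) (h : ∀ v, deg G v = r ∨ deg G v = r + 1) :
    ∃ F ≤ G, ∀ v, deg F v = k ∨ deg F v = k + 1 := by
  induction r generalizing G with
  | zero => exact ⟨G, le_rfl, fun v => by have := h v; omega⟩
  | succ r ih =>
    rcases hk.eq_or_lt with rfl | hlt
    · exact ⟨G, le_rfl, h⟩
    obtain ⟨G', hG', hd, T, hT, hT1, hTU⟩ := exists_factor_with_matching G (r + 1) h
    -- Without `T`, degrees r + 2 drop to r + 1 and degrees r + 1 drop by at most one.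
    obtain ⟨F, hF, hFd⟩ := ih (G' \ T) (by omega) (fun v => by
      have := deg_add_deg_sdiff hT v
      have := hT1 v
      have := hTU v
      have := hd v
      omega)
    exact ⟨F, hF.trans (sdiff_le.trans hG'), hFd⟩

/-- Disjoint factors `F` and `K` for which the interval `[deg F v, deg F v + deg K v]` of
degrees that are attainable by adding edges of `K` to `F` contains `[m, M]`, with `K` of small
maximum degree. -/
theorem exists_interval_factors {V : Type*} [Finite V] (G : SimpleGraph V) (r m M : ℕ)
    (hm : 1 ≤ m) (hmM : m ≤ M) (hMr : M ≤ r) (h : ∀ v, deg G v = r ∨ deg G v = r + 1) :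
    ∃ F K : SimpleGraph V, F ≤ G ∧ K ≤ G ∧ Disjoint F K ∧ (∀ v, deg F v ≤ m) ∧
      (∀ v, M ≤ deg F v + deg K v) ∧ ∀ v, deg K v ≤ 2 * ((M - m + 2) / 2) := by
  obtain ⟨F₂, hF₂, hd⟩ := exists_near_regular_factor G r M hMr h
  rcases Nat.even_or_odd' (M - m) with ⟨c, hc | hc⟩
  · obtain ⟨F₁, hF₁, hd₁⟩ := exists_near_regular_factor F₂ M (m - 1) (by omega) hd
    refine ⟨F₁, F₂ \ F₁, hF₁.trans hF₂, sdiff_le.trans hF₂, disjoint_sdiff_self_right,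
      fun v => ?_, fun v => ?_, fun v => ?_⟩ <;>
    · have := hd v
      have := hd₁ v
      have := deg_add_deg_sdiff hF₁ v
      omega
  -- For odd M - m the bound 2k is only M - m + 1, so the previous choice may exceed it by one. Even
  -- splits are sharper: for M even, set aside a matching and split the rest into bounds m - 1 and M
  -- - m + 1; for M odd, split into m and M - m + 1 directly.
  rcases Nat.even_or_odd' M with ⟨j, hj | hj⟩
  · obtain ⟨G', hG', hd', T, hT, hT1, hTU⟩ := exists_factor_with_matching F₂ M hd
    have hT' := fun v => deg_add_deg_sdiff hT v
    obtain ⟨F₁, hF₁, hd₁, hd₂⟩ := exists_even_split (G' \ T) j ((m - 1) / 2) (by omega)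
      (fun v => by have := hT' v; have := hd' v; have := hTU v; omega)
      (fun v => by have := hT' v; have := hd' v; have := hT1 v; omega)
    have hdis : Disjoint F₁ T := disjoint_sdiff_self_left.mono_left hF₁
    refine ⟨F₁ ⊔ T, (G' \ T) \ F₁, (sup_le (hF₁.trans sdiff_le) hT).trans (hG'.trans hF₂),
      sdiff_le.trans (sdiff_le.trans (hG'.trans hF₂)), ?_,
      fun v => ?_, fun v => ?_, fun v => ?_⟩
    · rw [disjoint_sup_left]
      exact ⟨disjoint_sdiff_self_right, disjoint_sdiff_self_right.mono_right sdiff_le⟩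
    · rw [deg_sup hdis]
      have := hd₁ v
      have := hT1 v
      omega
    · rw [deg_sup hdis]
      have := deg_add_deg_sdiff hF₁ v
      have := hT' v
      have := hd' v
      omega
    · have := hd₂ v
      omega
  · obtain ⟨F₁, hF₁, hd₁, hd₂⟩ := exists_even_split F₂ (j + 1) (m / 2) (by omega)
      (fun v => by have := hd v; omega) (fun v => by have := hd v; omega)
    refine ⟨F₁, F₂ \ F₁, hF₁.trans hF₂, sdiff_le.trans hF₂, disjoint_sdiff_self_right,
      fun v => ?_, fun v => ?_, fun v => ?_⟩
    · have := hd₁ v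
      omega
    · have := hd v
      have := deg_add_deg_sdiff hF₁ v
      omega
    · have := hd₂ v
      omega

/-! ### Avoiding forbidden degrees -/

/-- If every vertex is the tail of at least as many arcs as there are forbidden degrees, then
some set of arcs avoids all forbidden degrees (Frank, Lau and Szabó). -/
theorem exists_avoiding_arcs {V : Type*} [DecidableEq V] (D : Finset (V × V)) (F : V → Finset ℕ)
    (hD : ∀ a ∈ D, a.1 ≠ a.2) (h : ∀ v, #(F v) ≤ #{a ∈ D | a.1 = v}) :
    ∃ E ⊆ D, ∀ v, #{a ∈ E | a.1 = v} + #{a ∈ E | a.2 = v} ∉ F v := by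
  induction hn : #D generalizing D F with
  | zero =>
    obtain rfl := card_eq_zero.1 hn
    refine ⟨∅, subset_rfl, fun v => ?_⟩
    have := h v
    simp only [filter_empty, card_empty, nonpos_iff_eq_zero, card_eq_zero] at this
    simp [this]
  | succ n ih =>
    -- If 0 is forbidden nowhere, the empty set works. Otherwise commit an arc out of such a t and
    -- shift the forbidden sets at both ends down by one: t loses one arc but also the forbidden
    -- value 0, and the head loses no outgoing arc.
    by_cases h0 : ∃ t, 0 ∈ F t
    swap
    · exact ⟨∅, empty_subset _, fun v hv => h0 ⟨v, by simpa using hv⟩⟩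
    obtain ⟨t, ht⟩ := h0
    obtain ⟨a, ha⟩ := card_pos.1 ((card_pos.2 ⟨0, ht⟩).trans_le (h t))
    obtain ⟨haD, rfl⟩ := mem_filter.1 ha
    let F' : V → Finset ℕ := fun v =>
      if a.1 = v ∨ a.2 = v then ((F v).erase 0).image Nat.pred else F v
    have key : ∀ v, ∀ i, (a.1 = v ∨ a.2 = v) → i ∉ F' v → i + 1 ∉ F v := by
      intro v i hv hi hi'
      simp only [F', if_pos hv, mem_image, mem_erase, not_exists, not_and] at hi
      exact hi (i + 1) ⟨i.succ_ne_zero, hi'⟩ rfl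
    obtain ⟨E, hE, hav⟩ := ih (D.erase a) F' (fun b hb => hD b (mem_of_mem_erase hb))
      (fun v => by
        rw [filter_erase]
        by_cases hv : a.1 = v
        · subst hv
          rw [card_erase_of_mem ha]
          simp only [F', true_or, if_true]
          refine card_image_le.trans ?_
          rw [card_erase_of_mem ht]
          exact Nat.sub_le_sub_right (h _) 1
        · rw [erase_eq_of_notMem (by simp [hv])]
          refine le_trans ?_ (h v)
          simp only [F']
          split_ifs
          · exact card_image_le.trans (card_le_card (erase_subset _ _))
          · exact le_rfl)
      (by rw [card_erase_of_mem haD, hn]; rfl)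
    have haE : a ∉ E := fun h => notMem_erase a D (hE h)
    refine ⟨insert a E, insert_subset haD (hE.trans (erase_subset _ _)), fun v => ?_⟩
    have hv := hav v
    have hne := hD a haD
    rw [filter_insert, filter_insert]
    by_cases h1 : a.1 = v
    · have h2 : a.2 ≠ v := fun h2 => hne (h1.trans h2.symm)
      rw [if_pos h1, if_neg h2, card_insert_of_notMem (by simp [haE]), add_right_comm]
      exact key v _ (Or.inl h1) hv
    · by_cases h2 : a.2 = v
      · rw [if_neg h1, if_pos h2, card_insert_of_notMem (by simp [haE]), ← add_assoc]
        exact key v _ (Or.inr h2) hv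
      · rw [if_neg h1, if_neg h2]
        simpa only [F', h1, h2, or_self, if_false] using hv

/-- If `K` has maximum degree at most `2 * k` and at most `deg K v - k` degrees are forbidden at
each vertex `v`, then `K` has a factor that avoids the forbidden degrees. -/
theorem exists_avoiding_factor {V : Type*} [Finite V] (K : SimpleGraph V) (k : ℕ)
    (hK : ∀ v, deg K v ≤ 2 * k) (F : V → Finset ℕ) (hF : ∀ v, #(F v) ≤ deg K v - k) :
    ∃ E ≤ K, ∀ v, deg E v ∉ F v := by
  classical
  have := Fintype.ofFinite V
  obtain ⟨D, h1, h2, h3⟩ := exists_orientation K k hK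
  have hcard : ∀ (A : Finset (V × V)) v, #{a ∈ A | a.1 = v} = {w | (v, w) ∈ A}.ncard ∧
      #{a ∈ A | a.2 = v} = {w | (w, v) ∈ A}.ncard := by
    intro A v
    rw [← Set.ncard_image_of_injective {w | (v, w) ∈ A} (Prod.mk_right_injective v),
      ← Set.ncard_image_of_injective {w | (w, v) ∈ A} (Prod.mk_left_injective v),
      ← Set.ncard_coe_finset, ← Set.ncard_coe_finset]
    constructor <;>
    · congr 1
      ext ⟨x, y⟩
      simp only [coe_filter, Set.mem_ofPred_eq, Set.mem_image, Prod.mk.injEq]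
      constructor
      · rintro ⟨h, rfl⟩
        exact ⟨_, h, rfl, rfl⟩
      · rintro ⟨_, h, rfl, rfl⟩
        exact ⟨h, rfl⟩
  obtain ⟨E, hE, hav⟩ := exists_avoiding_arcs ({a | D a.1 a.2} : Finset (V × V)) F
    (by
      rintro ⟨x, y⟩ ha hxy
      obtain rfl : x = y := hxy
      have hx : D x x := by simpa using ha
      exact h2 x x hx hx)
    (fun v => by
      rw [(hcard _ v).1]
      refine (hF v).trans ?_
      have := h3 v
      have := deg_eq_out_add_in K D h1 h2 v
      simp only [mem_filter, mem_univ, true_and]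
      omega)
  have hED : ∀ v w, (v, w) ∈ E → D v w := fun v w h => by simpa using hE h
  let E' : SimpleGraph V :=
    { Adj := fun v w => (v, w) ∈ E ∨ (w, v) ∈ E
      symm := ⟨fun v w h => h.symm⟩
      loopless := ⟨fun v h => by
        have h' := hED v v (by simpa using h)
        exact h2 v v h' h'⟩ }
  refine ⟨E', ?_, fun v => ?_⟩
  · rintro v w (h | h)
    · exact (h1 v w).2 (Or.inl (hED _ _ h))
    · exact (h1 v w).2 (Or.inr (hED _ _ h))
  · rw [deg_eq_out_add_in E' (fun v w => (v, w) ∈ E) (fun v w => Iff.rfl)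
      (fun v w h h' => h2 v w (hED _ _ h) (hED _ _ h'))]
    have := hav v
    rwa [(hcard E v).1, (hcard E v).2] at this

/-! ### Existence of the factor -/

theorem exists_factor_of_card_le {V : Type*} [Finite V] (G : SimpleGraph V) (r m M : ℕ)
    (hm : 1 ≤ m) (hmM : m ≤ M) (hMr : M ≤ r) (h : ∀ v, deg G v = r ∨ deg G v = r + 1)
    (H : V → Set ℕ) (hH : ∀ v, H v ⊆ Set.Icc m M) (hcard : ∀ v, M - m + 3 ≤ 2 * (H v).ncard) :
    ∃ F ≤ G, ∀ v, deg F v ∈ H v := by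
  classical
  obtain ⟨F, K, hFG, hKG, hdis, hFm, hM, hK⟩ := exists_interval_factors G r m M hm hmM hMr h
  set k := (M - m + 2) / 2 with hk
  obtain ⟨E, hE, hav⟩ := exists_avoiding_factor K k hK
    -- All of H(v) lies in [deg F, deg F + deg K], so at most deg K + 1 - (k + 1) values of i are
    -- forbidden.
    (fun v => {i ∈ range (deg K v + 1) | deg F v + i ∉ H v}) (fun v => by
      have h1 := card_filter_add_card_filter_not (s := range (deg K v + 1))
        (fun i => deg F v + i ∈ H v)
      have h2 : (H v).ncard ≤ #{i ∈ range (deg K v + 1) | deg F v + i ∈ H v} := by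
        rw [← card_image_of_injective _ (add_right_injective (deg F v)), ← Set.ncard_coe_finset]
        refine Set.ncard_le_ncard ?_ (Set.toFinite _)
        intro x hx
        have := hH v hx
        have := hFm v
        have := hM v
        simp only [Set.mem_Icc] at *
        simp only [coe_image, coe_filter, mem_range, Set.mem_image, Set.mem_ofPred_eq]
        refine ⟨x - deg F v, ⟨by omega, ?_⟩, by omega⟩
        rwa [Nat.add_sub_cancel' (by omega)]
      rw [card_range] at h1
      have := hcard v
      omega)
  refine ⟨F ⊔ E, sup_le hFG (hE.trans hKG), fun v => ?_⟩
  rw [deg_sup (hdis.mono_right hE)]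
  have := hav v
  have := deg_mono hE v
  by_contra hcon
  exact hav v (mem_filter.2 ⟨mem_range.2 (by omega), hcon⟩)

theorem hasFactor_iff {V : Type*} [Fintype V] (G : SimpleGraph V) (H : V → Set ℕ) :
    HasFactor G H ↔ ∃ F ≤ G, ∀ v, deg F v ∈ H v := by
  classical
  constructor
  · rintro ⟨F, _, hF, h⟩
    exact ⟨F, hF, fun v => degree_eq_deg F v ▸ h v⟩
  · rintro ⟨F, hF, h⟩
    exact ⟨F, Classical.decRel _, hF, fun v => by rw [degree_eq_deg]; exact h v⟩

theorem hasFactor_of_isNearRegular {V : Type*} [Fintype V] (G : SimpleGraph V)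
    [DecidableRel G.Adj] (r : ℕ) (H : V → Set ℕ) (hG : IsNearRegular G r)
    (hH : IsSetFunction G H) (hm : 1 ≤ minH H) (hM : maxH H ≤ r)
    (hcard : ∀ v, ((maxH H : ℚ) - (minH H : ℚ) + 3) / 2 ≤ ((H v).ncard : ℚ)) :
    HasFactor G H := by
  rw [hasFactor_iff]
  have hbdd : ∀ v, BddAbove (H v) := fun v => ⟨G.degree v, fun x hx => (hH v hx).2⟩
  have hmin : ∀ v, minH H ≤ sInf (H v) := fun v => ciInf_le (OrderBot.bddBelow _) v
  have hmax : ∀ v, sSup (H v) ≤ maxH H := fun v =>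
    le_ciSup (f := fun v => sSup (H v)) (Set.finite_range _).bddAbove v
  have hsub : ∀ v, H v ⊆ Set.Icc (minH H) (maxH H) := fun v x hx =>
    ⟨(hmin v).trans (Nat.sInf_le hx), (le_csSup (hbdd v) hx).trans (hmax v)⟩
  rcases isEmpty_or_nonempty V with hV | ⟨⟨v₀⟩⟩
  · exact ⟨⊥, bot_le, fun v => hV.elim v⟩
  -- An empty H(v) would have `sInf` equal to 0, contradicting mH ≥ 1.
  have hmM : minH H ≤ maxH H := by
    rcases (H v₀).eq_empty_or_nonempty with h | ⟨x, hx⟩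
    · have := hmin v₀
      rw [h, Nat.sInf_empty] at this
      omega
    · exact (hsub v₀ hx).1.trans (hsub v₀ hx).2
  refine exists_factor_of_card_le G r (minH H) (maxH H) hm hmM hM
    (fun v => by rw [← degree_eq_deg]; exact hG v) H hsub (fun v => ?_)
  have h1 := hcard v
  rw [← Nat.cast_sub hmM] at h1
  have h2 : ((maxH H - minH H + 3 : ℕ) : ℚ) ≤ ((2 * (H v).ncard : ℕ) : ℚ) := by
    push_cast
    linarith
  exact_mod_cast h2

/-! ### Sharpness: parity obstructions -/

theorem even_card_odd_deg {W : Type*} [Finite W] (K : SimpleGraph W) :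
    Even {w | Odd (deg K w)}.ncard := by
  classical
  have := Fintype.ofFinite W
  have h := K.even_card_odd_degree_vertices
  rw [← Set.ncard_coe_finset] at h
  simpa [degree_eq_deg] using h

/-- Neighbours split into those inside and outside the image of f. This lets the parity argument be
applied to a single block of a larger graph. -/
theorem deg_comap_add {V W : Type*} [Finite V] (F : SimpleGraph V) (f : W → V)
    (hf : Function.Injective f) (w : W) :
    deg (F.comap f) w + {x | F.Adj (f w) x ∧ x ∉ Set.range f}.ncard = deg F (f w) := by
  rw [deg, ← Set.ncard_image_of_injective _ hf, ← Set.ncard_union_eq _ (Set.toFinite _)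
    (Set.toFinite _), deg]
  · congr 1
    ext x
    simp only [Set.mem_union, Set.mem_image, SimpleGraph.mem_neighborSet, SimpleGraph.comap_adj,
      Set.mem_ofPred_eq, Set.mem_range]
    constructor
    · rintro (⟨y, hy, rfl⟩ | ⟨hx, -⟩)
      · exact hy
      · exact hx
    · intro hx
      by_cases hr : ∃ y, f y = x
      · obtain ⟨y, rfl⟩ := hr
        exact Or.inl ⟨y, hx, rfl⟩
      · exact Or.inr ⟨hx, hr⟩
  · rw [Set.disjoint_left]
    rintro _ ⟨y, -, rfl⟩ ⟨-, h⟩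
    exact h ⟨y, rfl⟩

theorem deg_comap_of_forall_mem_range {V W : Type*} [Finite V] (F : SimpleGraph V) (f : W → V)
    (hf : Function.Injective f) (w : W) (h : ∀ x, F.Adj (f w) x → x ∈ Set.range f) :
    deg (F.comap f) w = deg F (f w) := by
  rw [← deg_comap_add F f hf w, left_eq_add, Set.ncard_eq_zero (Set.toFinite _)]
  ext x
  simpa using h x

/-- The arithmetic progression `{a, a + 2, …, a + 2 * t}`. -/
def stepSet (a t : ℕ) : Set ℕ := (fun i => a + 2 * i) '' Set.Iic t

theorem ncard_stepSet (a t : ℕ) : (stepSet a t).ncard = t + 1 := by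
  rw [stepSet, Set.ncard_image_of_injective _ (fun x y h => by simpa using h)]
  simp [Set.ncard_eq_toFinset_card']

theorem sInf_stepSet (a t : ℕ) : sInf (stepSet a t) = a :=
  IsLeast.csInf_eq ⟨⟨0, by simp, by simp⟩, by rintro _ ⟨i, -, rfl⟩; simp⟩

theorem sSup_stepSet (a t : ℕ) : sSup (stepSet a t) = a + 2 * t :=
  IsGreatest.csSup_eq ⟨⟨t, by simp, rfl⟩, by
    rintro _ ⟨i, hi, rfl⟩
    simp only [Set.mem_Iic] at hi
    simpa using hi⟩

theorem stepSet_eq (a t : ℕ) :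
    stepSet a t = {h | ∃ i : ℕ, h = a + 2 * i ∧ h ≤ a + 2 * t} := by
  ext h
  simp only [stepSet, Set.mem_image, Set.mem_Iic, Set.mem_ofPred_eq]
  constructor
  · rintro ⟨i, hi, rfl⟩
    exact ⟨i, rfl, by omega⟩
  · rintro ⟨i, rfl, hi⟩
    exact ⟨i, by omega, rfl⟩

theorem le_of_mem_stepSet {a t x : ℕ} (h : x ∈ stepSet a t) : a ≤ x ∧ x ≤ a + 2 * t := by
  obtain ⟨i, hi, rfl⟩ := h
  simp only [Set.mem_Iic] at hi
  dsimp only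
  omega

theorem mod_two_of_mem_stepSet {a t x : ℕ} (h : x ∈ stepSet a t) : x % 2 = a % 2 := by
  obtain ⟨i, hi, rfl⟩ := h
  dsimp only
  omega

theorem minH_const {V : Type*} [Nonempty V] (S : Set ℕ) : minH (fun _ : V => S) = sInf S :=
  ciInf_const

theorem maxH_const {V : Type*} [Nonempty V] (S : Set ℕ) : maxH (fun _ : V => S) = sSup S :=
  ciSup_const

theorem isRegularOfDegree_of_deg {V : Type*} [Fintype V] {G : SimpleGraph V} [DecidableRel G.Adj]
    {r : ℕ} (h : ∀ v, deg G v = r) : G.IsRegularOfDegree r :=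
  fun v => by rw [degree_eq_deg, h v]

theorem deg_top (n : ℕ) (v : Fin (n + 1)) : deg (⊤ : SimpleGraph (Fin (n + 1))) v = n := by
  rw [← degree_eq_deg]
  simp

theorem not_forall_odd_deg {W : Type*} [Finite W] (hW : Odd (Nat.card W)) (K : SimpleGraph W) :
    ¬ ∀ w, Odd (deg K w) := by
  intro h
  have h1 := even_card_odd_deg K
  rw [Set.eq_univ_of_forall (s := {w | Odd (deg K w)}) h, Set.ncard_univ] at h1
  exact Nat.not_even_iff_odd.2 hW h1

theorem not_exists_unique_odd_deg {W : Type*} [Finite W] (K : SimpleGraph W) :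
    ¬ ∃ w, ∀ v, Odd (deg K v) ↔ v = w := by
  rintro ⟨w, h⟩
  have h1 := even_card_odd_deg K
  have : {v | Odd (deg K v)} = {w} := by
    ext v
    exact h v
  rw [this, Set.ncard_singleton] at h1
  exact Nat.not_even_one h1

/-- Two disjoint copies of the complete graph on `r + 1` vertices: the two parity classes. -/
def twoCliques (r : ℕ) : SimpleGraph (Fin (2 * (r + 1))) where
  Adj a b := a ≠ b ∧ (a : ℕ) % 2 = (b : ℕ) % 2
  symm := ⟨fun _ _ h => ⟨h.1.symm, h.2.symm⟩⟩
  loopless := ⟨fun _ h => h.1 rfl⟩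

/-- The enumeration of the parity class `b` among the vertices of `twoCliques r`. -/
def parityClass (r : ℕ) (b : Fin 2) (i : Fin (r + 1)) : Fin (2 * (r + 1)) :=
  ⟨2 * i + b, by omega⟩

theorem parityClass_injective (r : ℕ) (b : Fin 2) : Function.Injective (parityClass r b) := by
  intro x y h
  simp only [parityClass, Fin.mk.injEq] at h
  omega

theorem mem_range_parityClass {r : ℕ} {b : Fin 2} {i : Fin (r + 1)} {x : Fin (2 * (r + 1))}
    (h : (twoCliques r).Adj (parityClass r b i) x) : x ∈ Set.range (parityClass r b) := by
  have h2 := h.2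
  simp only [parityClass] at h2
  refine ⟨⟨x / 2, by omega⟩, ?_⟩
  ext
  simp only [parityClass]
  omega

theorem deg_twoCliques (r : ℕ) (v : Fin (2 * (r + 1))) : deg (twoCliques r) v = r := by
  obtain ⟨b, i, rfl⟩ : ∃ b i, v = parityClass r b i := by
    refine ⟨⟨v % 2, by omega⟩, ⟨v / 2, by omega⟩, ?_⟩
    ext
    simp only [parityClass]
    omega
  rw [← deg_comap_of_forall_mem_range _ _ (parityClass_injective r b) i
    (fun _ => mem_range_parityClass)]
  have : (twoCliques r).comap (parityClass r b) = ⊤ := by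
    ext x y
    simp only [SimpleGraph.comap_adj, twoCliques, SimpleGraph.top_adj,
      (parityClass_injective r b).ne_iff]
    refine and_iff_left ?_
    simp only [parityClass]
    omega
  rw [this, deg_top]

theorem sharp_even_order (r m M : ℕ) (hr : Even r) (hm : Odd m) (hM : Odd M) (hmM : m ≤ M)
    (hMr : (M : ℚ) ≤ (r : ℚ) / 2 - 2) :
    ∃ (n : ℕ) (G : SimpleGraph (Fin n)) (_ : DecidableRel G.Adj) (H : Fin n → Set ℕ),
      Even n ∧ G.IsRegularOfDegree r ∧
      (∀ v, H v = {h | ∃ i : ℕ, h = m + 2 * i ∧ h ≤ M}) ∧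
      IsSetFunction G H ∧ minH H = m ∧ maxH H = M ∧
      (∀ v, ((H v).ncard : ℚ) = ((M : ℚ) - (m : ℚ) + 2) / 2) ∧
      ¬ HasFactor G H := by
  classical
  obtain ⟨t, rfl⟩ : ∃ t, M = m + 2 * t := by
    obtain ⟨a, rfl⟩ := hm
    obtain ⟨b, rfl⟩ := hM
    exact ⟨b - a, by omega⟩
  have hMr' : m + 2 * t ≤ r := by
    have h1 : ((m + 2 * t : ℕ) : ℚ) ≤ (r : ℚ) := by
      have : (0 : ℚ) ≤ r := by positivity
      linarith
    exact_mod_cast h1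
  refine ⟨2 * (r + 1), twoCliques r, Classical.decRel _, fun _ => stepSet m t, even_two_mul _,
    isRegularOfDegree_of_deg (deg_twoCliques r), fun _ => stepSet_eq m t, ?_, ?_, ?_, ?_, ?_⟩
  · intro v x hx
    rw [degree_eq_deg, deg_twoCliques]
    exact ⟨Nat.zero_le _, (le_of_mem_stepSet hx).2.trans hMr'⟩
  · rw [minH_const, sInf_stepSet]
  · rw [maxH_const, sSup_stepSet]
  · intro v
    rw [ncard_stepSet]
    push_cast
    ring
  · rw [hasFactor_iff]
    rintro ⟨F, hF, h⟩
    refine not_forall_odd_deg ?_ (F.comap (parityClass r 0)) (fun i => ?_)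
    · rw [Nat.card_eq_fintype_card, Fintype.card_fin]
      exact hr.add_one
    · rw [deg_comap_of_forall_mem_range F _ (parityClass_injective r 0) i
        (fun x hx => mem_range_parityClass (hF hx)), Nat.odd_iff, mod_two_of_mem_stepSet (h _),
        ← Nat.odd_iff]
      exact hm

/-- An almost regular graph: `none` has degree `2 * q` and all other vertices have degree
`2 * q + 1`. -/
def pendantBlock (q : ℕ) : SimpleGraph (Option (Fin (q + 1) × Bool)) where
  Adj
    | none, none => False
    | none, some p => p.1 ≠ 0
    | some p, none => p.1 ≠ 0
    | some p, some p' => p.1 ≠ p'.1 ∨ (p.1 = 0 ∧ p'.1 = 0 ∧ p.2 ≠ p'.2)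
  symm := ⟨by
    rintro (_ | ⟨i, b⟩) (_ | ⟨j, c⟩) h
    · exact h
    · exact h
    · exact h
    · rcases h with h | ⟨h1, h2, h3⟩
      · exact Or.inl h.symm
      · exact Or.inr ⟨h2, h1, h3.symm⟩⟩
  loopless := ⟨by
    rintro (_ | ⟨i, b⟩) h
    · exact h
    · rcases h with h | ⟨h1, h2, h3⟩
      · exact h rfl
      · exact h3 rfl⟩

theorem ncard_fst_ne (q : ℕ) (i : Fin (q + 1)) :
    {p : Fin (q + 1) × Bool | p.1 ≠ i}.ncard = 2 * q := by
  have : {p : Fin (q + 1) × Bool | p.1 ≠ i} = ({i}ᶜ : Set (Fin (q + 1))) ×ˢ Set.univ := by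
    ext p
    simp
  rw [this, Set.ncard_prod, Set.ncard_compl, Set.ncard_univ]
  simp [mul_comm]

/-- The block is the complete graph on 2q + 3 vertices minus a q-edge matching and a two-edge path
centred at `none`. -/
theorem deg_pendantBlock (q : ℕ) (c : Option (Fin (q + 1) × Bool)) :
    deg (pendantBlock q) c = 2 * q + if c = none then 0 else 1 := by
  have hinj := Option.some_injective (Fin (q + 1) × Bool)
  rcases c with _ | ⟨i, b⟩
  · have : (pendantBlock q).neighborSet none = some '' {p | p.1 ≠ 0} := by
      ext (_ | p) <;> simp [pendantBlock]
    rw [deg, this, Set.ncard_image_of_injective _ hinj, ncard_fst_ne]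
    simp
  · by_cases hi : i = 0
    · have : (pendantBlock q).neighborSet (some (i, b)) =
          insert (some (i, !b)) (some '' {p | p.1 ≠ i}) := by
        subst hi
        ext (_ | ⟨j, c⟩)
        · simp [pendantBlock]
        · cases b <;> cases c <;> simp [pendantBlock, eq_comm, or_comm, em]
      rw [deg, this, Set.ncard_insert_of_notMem (by simp), Set.ncard_image_of_injective _ hinj,
        ncard_fst_ne]
      simp
    · have : (pendantBlock q).neighborSet (some (i, b)) =
          insert none (some '' {p | p.1 ≠ i}) := by
        ext (_ | ⟨j, c⟩) <;> simp [pendantBlock, hi, eq_comm]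
      rw [deg, this, Set.ncard_insert_of_notMem (by simp), Set.ncard_image_of_injective _ hinj,
        ncard_fst_ne]
      simp

/-- A vertex `none` joined by bridges to `2 * q + 1` copies of `pendantBlock q`. -/
def bridgeStar (q : ℕ) : SimpleGraph (Option (Fin (2 * q + 1) × Option (Fin (q + 1) × Bool))) where
  Adj
    | none, none => False
    | none, some p => p.2 = none
    | some p, none => p.2 = none
    | some p, some p' => p.1 = p'.1 ∧ (pendantBlock q).Adj p.2 p'.2
  symm := ⟨by
    rintro (_ | p) (_ | p') h
    · exact h
    · exact h
    · exact h
    · exact ⟨h.1.symm, h.2.symm⟩⟩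
  loopless := ⟨by
    rintro (_ | p) h
    · exact h
    · exact (pendantBlock q).loopless.irrefl _ h.2⟩

theorem deg_bridgeStar (q : ℕ) (v) : deg (bridgeStar q) v = 2 * q + 1 := by
  rcases v with _ | ⟨i, c⟩
  · have : (bridgeStar q).neighborSet none = Set.range (fun i => some (i, none)) := by
      ext (_ | ⟨i, c⟩)
      · simp [bridgeStar]
      · simp [bridgeStar, eq_comm]
    rw [deg, this, ← Set.image_univ, Set.ncard_image_of_injective _ (fun x y h => by simpa using h),
      Set.ncard_univ]
    simp
  · have hinj : Function.Injective
        (fun c : Option (Fin (q + 1) × Bool) => some (i, c)) := fun x y h => by simpa using h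
    rw [← deg_comap_add (bridgeStar q) (fun c => some (i, c)) hinj]
    have h1 : (bridgeStar q).comap (fun c => some (i, c)) = pendantBlock q := by
      ext x y
      simp [bridgeStar]
    have h2 : {x | (bridgeStar q).Adj (some (i, c)) x ∧ x ∉ Set.range (fun c => some (i, c))} =
        if c = none then {none} else ∅ := by
      ext (_ | ⟨j, d⟩)
      · split_ifs with h <;> simp [bridgeStar, h]
      · split_ifs with h <;> simp +contextual [bridgeStar]
    rw [h1, h2, deg_pendantBlock]
    split_ifs <;> simp

/-- In a factor of `bridgeStar q` with even degrees no bridge is used. -/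
theorem deg_none_eq_zero_of_even (q : ℕ) (F : SimpleGraph _) (hF : F ≤ bridgeStar q)
    (h : ∀ v, Even (deg F v)) : deg F none = 0 := by
  rw [deg, Set.ncard_eq_zero (Set.toFinite _)]
  ext x
  simp only [SimpleGraph.mem_neighborSet, Set.mem_empty_iff_false, iff_false]
  intro hx
  rcases x with _ | ⟨i, c⟩
  · exact F.loopless.irrefl _ hx
  obtain rfl : c = none := hF hx
  have hinj : Function.Injective
      (fun c : Option (Fin (q + 1) × Bool) => some (i, c)) := fun x y h => by simpa using h
  -- If the bridge were used, restricting F to the block would make its end the only vertex of odd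
  -- degree.
  refine not_exists_unique_odd_deg (F.comap (fun c => some (i, c))) ⟨none, fun c => ?_⟩
  have h1 := deg_comap_add F _ hinj c
  have h2 : {x | F.Adj (some (i, c)) x ∧ x ∉ Set.range (fun c => some (i, c))} =
      if c = none then {none} else ∅ := by
    ext (_ | ⟨j, d⟩)
    · split_ifs with hc
      · subst hc
        simpa using hx.symm
      · simp only [Set.mem_ofPred_eq, Set.mem_empty_iff_false, iff_false]
        exact fun h' => hc (hF h'.1)
    · have : F.Adj (some (i, c)) (some (j, d)) → i = j := fun h' => (hF h').1
      split_ifs with hc <;> simp +contextual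
      · exact fun h' => this h'
      · exact fun h' => this h'
  rw [h2] at h1
  have h3 := h (some (i, c))
  rw [← h1] at h3
  split_ifs at h3 with hc
  · simpa [hc, Nat.even_add_one] using h3
  · simpa [hc] using h3

/-- On a complete graph, one vertex receives the odd one of the progressions starting at m and m +
1, all others the even one. Together they attain both extremes, but exactly one degree would be odd.
-/
theorem sharp_of_odd_sub (m t : ℕ) :
    ∃ (r n : ℕ) (G : SimpleGraph (Fin n)) (_ : DecidableRel G.Adj) (H : Fin n → Set ℕ),
      m + 2 * t + 1 ≤ r ∧ G.IsRegularOfDegree r ∧ IsSetFunction G H ∧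
      minH H = m ∧ maxH H = m + 2 * t + 1 ∧ (∀ v, (H v).ncard = t + 1) ∧ ¬ HasFactor G H := by
  classical
  obtain ⟨a, b, ha, hb, hab⟩ : ∃ a b, Odd a ∧ Even b ∧ (a = m ∧ b = m + 1 ∨ a = m + 1 ∧ b = m) := by
    rcases Nat.even_or_odd m with h | h
    · exact ⟨m + 1, m, h.add_one, h, Or.inr ⟨rfl, rfl⟩⟩
    · exact ⟨m, m + 1, h, h.add_one, Or.inl ⟨rfl, rfl⟩⟩
  let H : Fin (m + 2 * t + 1 + 1) → Set ℕ := fun v => stepSet (if v = 0 then a else b) t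
  obtain ⟨v₀, v₁, h₀, h₁⟩ : ∃ v₀ v₁, H v₀ = stepSet m t ∧ H v₁ = stepSet (m + 1) t := by
    have : (1 : Fin (m + 2 * t + 1 + 1)) ≠ 0 := by simp
    rcases hab with ⟨rfl, rfl⟩ | ⟨rfl, rfl⟩
    · exact ⟨0, 1, by simp [H], by simp [H]⟩
    · exact ⟨1, 0, by simp [H], by simp [H]⟩
  have hle : ∀ v : Fin (m + 2 * t + 1 + 1), m ≤ (if v = 0 then a else b) ∧
      (if v = 0 then a else b) ≤ m + 1 := by
    intro v
    split_ifs <;> omega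
  refine ⟨m + 2 * t + 1, m + 2 * t + 1 + 1, ⊤, inferInstance, H, le_rfl,
    isRegularOfDegree_of_deg (deg_top _), ?_, ?_, ?_, fun v => ncard_stepSet _ _, ?_⟩
  · intro v x hx
    rw [degree_eq_deg, deg_top]
    have := le_of_mem_stepSet hx
    have := hle v
    exact ⟨Nat.zero_le _, by omega⟩
  · refine le_antisymm ?_ (le_ciInf fun v => ?_)
    · refine (ciInf_le (OrderBot.bddBelow _) v₀).trans ?_
      rw [h₀, sInf_stepSet]
    · rw [sInf_stepSet]
      exact (hle v).1
  · refine le_antisymm (ciSup_le fun v => ?_) ?_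
    · rw [sSup_stepSet]
      have := hle v
      omega
    · refine le_trans ?_ (le_ciSup (f := fun v => sSup (H v)) (Set.finite_range _).bddAbove v₁)
      simp only [h₁, sSup_stepSet]
      omega
  · rw [hasFactor_iff]
    rintro ⟨F, -, h⟩
    refine not_exists_unique_odd_deg F ⟨0, fun v => ?_⟩
    have := mod_two_of_mem_stepSet (h v)
    rw [Nat.odd_iff, this]
    split_ifs with hv
    · simpa [hv, Nat.odd_iff] using ha
    · simpa [hv, Nat.even_iff] using Nat.even_iff.1 hb

theorem sharp_const {n r m t : ℕ} (hn : 0 < n) (G : SimpleGraph (Fin n)) (hr : m + 2 * t ≤ r)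
    (hG : ∀ v, deg G v = r) (hF : ¬ ∃ F ≤ G, ∀ v, deg F v ∈ stepSet m t) :
    ∃ (r n : ℕ) (G : SimpleGraph (Fin n)) (_ : DecidableRel G.Adj) (H : Fin n → Set ℕ),
      m + 2 * t ≤ r ∧ G.IsRegularOfDegree r ∧ IsSetFunction G H ∧
      minH H = m ∧ maxH H = m + 2 * t ∧ (∀ v, (H v).ncard = t + 1) ∧ ¬ HasFactor G H := by
  classical
  have : Nonempty (Fin n) := ⟨⟨0, hn⟩⟩
  refine ⟨r, n, G, Classical.decRel _, fun _ => stepSet m t, hr, isRegularOfDegree_of_deg hG,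
    ?_, ?_, ?_, fun v => ncard_stepSet _ _, ?_⟩
  · intro v x hx
    rw [degree_eq_deg, hG]
    exact ⟨Nat.zero_le _, (le_of_mem_stepSet hx).2.trans hr⟩
  · rw [minH_const, sInf_stepSet]
  · rw [maxH_const, sSup_stepSet]
  · rwa [hasFactor_iff]

/-- For m odd, a complete graph of odd order m + 2t + 2 works. For m even, `bridgeStar` works: its
centre would have degree 0 < m. -/
theorem sharp_of_even_sub (m t : ℕ) (hm : 1 ≤ m) :
    ∃ (r n : ℕ) (G : SimpleGraph (Fin n)) (_ : DecidableRel G.Adj) (H : Fin n → Set ℕ),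
      m + 2 * t ≤ r ∧ G.IsRegularOfDegree r ∧ IsSetFunction G H ∧
      minH H = m ∧ maxH H = m + 2 * t ∧ (∀ v, (H v).ncard = t + 1) ∧ ¬ HasFactor G H := by
  rcases Nat.even_or_odd m with hev | hodd
  · obtain ⟨c, rfl⟩ := hev.two_dvd
    let e := (Fintype.equivFin
      (Option (Fin (2 * (c + t) + 1) × Option (Fin (c + t + 1) × Bool)))).symm
    have hdeg : ∀ (F : SimpleGraph _) v, deg (F.comap e) v = deg F (e v) := fun F v =>
      deg_comap_of_forall_mem_range F e e.injective v (fun x _ => e.surjective x)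
    refine sharp_const (r := 2 * (c + t) + 1) Fintype.card_pos ((bridgeStar (c + t)).comap e)
      (by omega) (fun v => by rw [hdeg, deg_bridgeStar]) ?_
    rintro ⟨F, hF, h⟩
    have hFe : (F.comap e.symm).comap e = F := by
      ext x y
      simp
    have hmem : ∀ v, deg (F.comap e.symm) v ∈ stepSet (2 * c) t := by
      intro v
      have := h (e.symm v)
      rwa [← hFe, hdeg, e.apply_symm_apply] at this
    have h0 := deg_none_eq_zero_of_even (c + t) (F.comap e.symm) (fun x y hxy => by
        simpa using hF hxy) (fun v => by
        rw [Nat.even_iff, mod_two_of_mem_stepSet (hmem v)]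
        omega)
    have := (le_of_mem_stepSet (hmem none)).1
    omega
  · refine sharp_const (r := m + 2 * t + 1) (Nat.succ_pos _) ⊤ (by omega) (deg_top _) ?_
    rintro ⟨F, -, h⟩
    refine not_forall_odd_deg ?_ F (fun v => ?_)
    · rw [Nat.card_eq_fintype_card, Fintype.card_fin]
      rw [Nat.odd_iff] at *
      omega
    · rw [Nat.odd_iff, mod_two_of_mem_stepSet (h v), ← Nat.odd_iff]
      exact hodd

theorem sharp_all (m M : ℕ) (hm : 1 ≤ m) (hmM : m ≤ M) :
    ∃ (r n : ℕ) (G : SimpleGraph (Fin n)) (_ : DecidableRel G.Adj) (H : Fin n → Set ℕ),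
      M ≤ r ∧ G.IsRegularOfDegree r ∧ IsSetFunction G H ∧ minH H = m ∧ maxH H = M ∧
      (∀ v, ((H v).ncard : ℤ) = ⌊((M : ℚ) - (m : ℚ) + 2) / 2⌋) ∧ ¬ HasFactor G H := by
  obtain ⟨d, rfl⟩ := Nat.exists_eq_add_of_le hmM
  rcases Nat.even_or_odd' d with ⟨t, rfl | rfl⟩
  · obtain ⟨r, n, G, i, H, h1, h2, h3, h4, h5, h6, h7⟩ := sharp_of_even_sub m t hm
    refine ⟨r, n, G, i, H, h1, h2, h3, h4, h5, fun v => ?_, h7⟩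
    rw [h6, eq_comm, Int.floor_eq_iff]
    push_cast
    constructor <;> linarith
  · obtain ⟨r, n, G, i, H, h1, h2, h3, h4, h5, h6, h7⟩ := sharp_of_odd_sub m t
    refine ⟨r, n, G, i, H, h1, h2, h3, h4, h5, fun v => ?_, h7⟩
    rw [h6, eq_comm, Int.floor_eq_iff]
    push_cast
    constructor <;> linarith

end GeneralFactor

theorem theorem1p9 :
    -- existence of the factor
    (∀ (V : Type*) [Fintype V] (G : SimpleGraph V) [DecidableRel G.Adj] (r : ℕ)
        (H : V → Set ℕ),
      GeneralFactor.IsNearRegular G r →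
      GeneralFactor.IsSetFunction G H →
      1 ≤ GeneralFactor.minH H →
      GeneralFactor.maxH H ≤ r →
      (∀ v, ((GeneralFactor.maxH H : ℚ) - (GeneralFactor.minH H : ℚ) + 3) / 2
        ≤ ((H v).ncard : ℚ)) →
      GeneralFactor.HasFactor G H) ∧
    -- sharpness: regular graphs of even order and the constant set `{m, m + 2, …, M}`
    (∀ r m M : ℕ, Even r → Odd m → Odd M → m ≤ M → (M : ℚ) ≤ (r : ℚ) / 2 - 2 →
      ∃ (n : ℕ) (G : SimpleGraph (Fin n)) (_ : DecidableRel G.Adj) (H : Fin n → Set ℕ),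
        Even n ∧ G.IsRegularOfDegree r ∧
        (∀ v, H v = {h | ∃ i : ℕ, h = m + 2 * i ∧ h ≤ M}) ∧
        GeneralFactor.IsSetFunction G H ∧
        GeneralFactor.minH H = m ∧ GeneralFactor.maxH H = M ∧
        (∀ v, ((H v).ncard : ℚ) = ((M : ℚ) - (m : ℚ) + 2) / 2) ∧
        ¬ GeneralFactor.HasFactor G H) ∧
    -- sharpness for every pair of extreme values
    (∀ m M : ℕ, 1 ≤ m → m ≤ M →
      ∃ (r n : ℕ) (G : SimpleGraph (Fin n)) (_ : DecidableRel G.Adj) (H : Fin n → Set ℕ),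
        M ≤ r ∧ G.IsRegularOfDegree r ∧
        GeneralFactor.IsSetFunction G H ∧
        GeneralFactor.minH H = m ∧ GeneralFactor.maxH H = M ∧
        (∀ v, ((H v).ncard : ℤ) = ⌊((M : ℚ) - (m : ℚ) + 2) / 2⌋) ∧
        ¬ GeneralFactor.HasFactor G H) := by
  refine ⟨fun V _ G _ r H => GeneralFactor.hasFactor_of_isNearRegular G r H,
    fun r m M hr hm hM hmM hMr => GeneralFactor.sharp_even_order r m M hr hm hM hmM hMr,
    fun m M hm hmM => GeneralFactor.sharp_all m M hm hmM⟩
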